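/- Let $\mathfrak A$ be a commutative unital $C^\star$-algebra and $M$ a finite-dimensional smooth manifold (Hausdorff, second countable, possibly with boundary). Write $\mathfrak X(M)$ for the smooth vector fields on $M$ and $\mathfrak X(M)^{\mathfrak A}=\mathfrak X(M)\otimes_{C^\infty(M)}C^\infty(M,\mathfrak A)$ for the smooth $\mathfrak A$-vector fields, i.e. the smooth sections of the bundle with fibres $T_pM\otimes_{\mathbb R}\mathfrak A$. They carry the involution $(X\otimes f)^*=X\otimes f^*$, act on $C^\infty(M,\mathfrak A)$ by $(X\otimes h)(f)=h\,X(f)$, and have the Lie bracket $$[X\otimes h,\,Y\otimes k]=[X,Y]\otimes hk+Y\otimes hX(k)-X\otimes kY(h).$$ An $\mathfrak A$-valued semi-Riemannian metric $\langle\cdot,\cdot\rangle$ on $M$ is a smooth family of maps $\langle\cdot,\cdot\rangle_p:(T_pM\otimes\mathfrak A)^2\to\mathfrak A$, $p\in M$, such that for all $u,v,w\in T_pM\otimes\mathfrak A$ and $a\in\mathfrak A$: $\langle v,u\rangle=\langle u,v\rangle^*$; $\langle au+v,w\rangle=a\langle u,w\rangle+\langle v,w\rangle$; $u=0$ whenever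 $\langle w',u\rangle=0$ for all $w'$; every $\mathfrak A$-linear map $T:T_pM\otimes\mathfrak A\to\mathfrak A$ has the form $T=\langle\cdot,x\rangle$ for some $x$; and $\langle u^*,v^*\rangle=\langle u,v\rangle^*$. An $\mathfrak A$-connection is a biadditive map $\nabla:\mathfrak X(M)^{\mathfrak A}\times\mathfrak X(M)^{\mathfrak A}\to\mathfrak X(M)^{\mathfrak A}$ with $\nabla_{fX}Y=f\nabla_XY$ and $\nabla_X(fY)=X(f)Y+f\nabla_XY$ for $f\in C^\infty(M,\mathfrak A)$; its curvature is $\mathcal R(X,Y)Z=\nabla_X\nabla_YZ-\nabla_Y\nabla_XZ-\nabla_{[X,Y]}Z$. The Levi-Civita connection of the metric is the $\mathfrak A$-connection $\nabla$ determined by the Koszul formula $$2\langle\nabla_XY,Z^*\rangle=X\langle Y,Z^*\rangle+Y\langle Z,X^*\rangle-Z\langle X,Y^*\rangle+\langle[X,Y],Z^*\rangle-\langle[Y,Z],X^*\rangle+\langle[Z,X],Y^*\rangle$$ for all $X,Y,Z\in\mathfrak X(M)^{\mathfrak A}$. Proposition. Let $\mathcal R$ be the curvature of the Levi-Civita connection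 of an $\mathfrak A$-valued semi-Riemannian metric on $M$. Then for all $X,Y,Z,V\in\mathfrak X(M)^{\mathfrak A}$: (i) $\langle\mathcal R(X,Y)Z,V\rangle=-\langle\mathcal R(X,Y)V^*,Z^*\rangle$; (ii) $\langle\mathcal R(X,Y)Z,V\rangle=\langle\mathcal R(Z,V^*)X,Y^*\rangle$. -/

import Mathlib

open scoped Manifold ContDiff TensorProduct

noncomputable section

namespace OperatorValued

section Functions

variable {E : Type*} [NormedAddCommGroup E] [NormedSpace ℝ E]
  {H : Type*} [TopologicalSpace H] (I : ModelWithCorners ℝ E H)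
  (M : Type*) [TopologicalSpace M] [ChartedSpace H M]
  (A : Type*) [CommCStarAlgebra A]

/-- Multiplication of `A` is smooth, so that smooth `A`-valued functions form a ring. -/
instance contMDiffRing_cstar : ContMDiffRing 𝓘(ℝ, A) ∞ A :=
  { (inferInstance : LieAddGroup 𝓘(ℝ, A) ∞ A) with
    contMDiff_mul := by
      have h := (contDiff_mul (𝕜 := ℝ) (𝔸 := A) (n := ∞)).contMDiff
      rwa [modelWithCornersSelf_prod, ← chartedSpaceSelf_prod] at h }

/-- `C^∞(M)`: smooth real functions. -/
abbrev RealFun := C^∞⟮I, M; 𝓘(ℝ, ℝ), ℝ⟯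

/-- `C^∞(M, 𝔄)`: smooth functions with values in the commutative C⋆-algebra `A`. -/
abbrev AFun := C^∞⟮I, M; 𝓘(ℝ, A), A⟯

instance algebraAFun : Algebra (RealFun I M) (AFun I M A) :=
  Algebra.ofModule
    (fun r f g => by ext x; exact smul_mul_assoc (r x) (f x) (g x))
    (fun r f g => by ext x; exact mul_smul_comm (r x) (f x) (g x))

/-- The pointwise involution `f ↦ f*` of `C^∞(M, 𝔄)`. -/
def starFun : AFun I M A →ₗ[RealFun I M] AFun I M A where
  toFun f := ⟨fun p => star (f p), (starL' ℝ : A ≃L[ℝ] A).contDiff.contMDiff.comp f.contMDiff⟩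
  map_add' f g := by ext p; exact star_add (f p) (g p)
  map_smul' r f := by
    ext p
    change star (r p • f p) = r p • star (f p)
    simp

end Functions

section VectorFields

variable {E : Type*} [NormedAddCommGroup E] [NormedSpace ℝ E]
  {H : Type*} [TopologicalSpace H] (I : ModelWithCorners ℝ E H)
  (M : Type*) [TopologicalSpace M] [ChartedSpace H M] [IsManifold I ∞ M]

/-- `𝔛(M)`: ordinary smooth vector fields. -/
abbrev VField := Cₛ^∞⟮I; E, (TangentSpace I : M → Type _)⟯

variable {I M}

/-- `C^∞(M)` acts pointwise on `𝔛(M)`. -/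
instance smulVField : SMul (RealFun I M) (VField I M) :=
  ⟨fun r X => ⟨fun p => r p • X p, r.contMDiff.smul_section X.contMDiff⟩⟩

instance moduleVField : Module (RealFun I M) (VField I M) where
  one_smul X := by ext p; exact one_smul ℝ (X p)
  mul_smul r s X := by ext p; exact mul_smul (r p) (s p) (X p)
  smul_zero r := by ext p; exact smul_zero (r p)
  smul_add r X Y := by ext p; exact smul_add (r p) (X p) (Y p)
  add_smul r s X := by ext p; exact add_smul (r p) (s p) (X p)
  zero_smul X := by ext p; exact zero_smul ℝ (X p)

/-- The derivative `X f` of a vector-valued smooth function along an ordinary vector field. -/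
def dirDeriv {V : Type*} [NormedAddCommGroup V] [NormedSpace ℝ V]
    (X : VField I M) (f : C^∞⟮I, M; 𝓘(ℝ, V), V⟯) : C^∞⟮I, M; 𝓘(ℝ, V), V⟯ :=
  ⟨fun p => mvfderiv I f p (X p), by
    have h1 := f.contMDiff.contMDiff_tangentMap (m := ∞) (by simp)
    exact ((contMDiff_snd_tangentBundle_modelSpace V 𝓘(ℝ, V)).of_le le_top).comp
      (h1.comp X.contMDiff)⟩

section dirDeriv

variable {V : Type*} [NormedAddCommGroup V] [NormedSpace ℝ V]

lemma dirDeriv_add_left (X Y : VField I M) (f : C^∞⟮I, M; 𝓘(ℝ, V), V⟯) :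
    dirDeriv (X + Y) f = dirDeriv X f + dirDeriv Y f := by
  ext p; exact map_add (mvfderiv I f p) (X p) (Y p)

lemma dirDeriv_smul_left (r : RealFun I M) (X : VField I M) (f : C^∞⟮I, M; 𝓘(ℝ, V), V⟯) :
    dirDeriv (r • X) f = r • dirDeriv X f := by
  ext p; exact map_smul (mvfderiv I f p) (r p) (X p)

lemma dirDeriv_add_right (X : VField I M) (f g : C^∞⟮I, M; 𝓘(ℝ, V), V⟯) :
    dirDeriv X (f + g) = dirDeriv X f + dirDeriv X g := by
  ext p
  exact congrArg (fun L => L (X p)) (mvfderiv_add (I := I) (f.mdifferentiable p)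
    (g.mdifferentiable p))

lemma dirDeriv_smul_right (X : VField I M) (r : RealFun I M) (f : C^∞⟮I, M; 𝓘(ℝ, V), V⟯) :
    dirDeriv X (r • f) = r • dirDeriv X f + dirDeriv X r • f := by
  ext p
  exact congrArg (fun L => L (X p)) (mvfderiv_smul (I := I) (r.mdifferentiable p)
    (f.mdifferentiable p))

end dirDeriv

lemma VField.mdiff (X : VField I M) (p : M) :
    MDifferentiableAt I I.tangent (fun x => (⟨x, X x⟩ : TangentBundle I M)) p :=
  (X.contMDiff.mdifferentiable (by simp)) p

variable [FiniteDimensional ℝ E]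

/-- The Lie bracket of ordinary smooth vector fields. -/
def vbracket (X Y : VField I M) : VField I M :=
  ⟨VectorField.mlieBracket I X Y, by
    have : CompleteSpace E := FiniteDimensional.complete ℝ E
    have : IsManifold I (((⊤ : ℕ∞) : WithTop ℕ∞) + 1) M := by simpa using ‹IsManifold I ∞ M›
    have : IsManifold I (minSmoothness ℝ 2) M :=
      IsManifold.of_le (n := ∞) (by
        rw [minSmoothness_of_isRCLikeNormedField]
        exact WithTop.coe_le_coe.2 (le_top : (2 : ℕ∞) ≤ ⊤))
    exact ContDiff.mlieBracket_vectorField (n := ⊤) (m := ⊤) X.contMDiff Y.contMDiff (by simp)⟩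

lemma vbracket_add_left (X X' Y : VField I M) :
    vbracket (X + X') Y = vbracket X Y + vbracket X' Y := by
  ext p; exact VectorField.mlieBracket_add_left (X.mdiff p) (X'.mdiff p)

lemma vbracket_add_right (X Y Y' : VField I M) :
    vbracket X (Y + Y') = vbracket X Y + vbracket X Y' := by
  ext p; exact VectorField.mlieBracket_add_right (Y.mdiff p) (Y'.mdiff p)

lemma vbracket_smul_left (r : RealFun I M) (X Y : VField I M) :
    vbracket (r • X) Y = r • vbracket X Y - dirDeriv Y r • X := by
  have : CompleteSpace E := FiniteDimensional.complete ℝ E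
  ext p
  refine (VectorField.mlieBracket_smul_left (r.mdifferentiable p) (X.mdiff p)).trans ?_
  rw [neg_smul, neg_add_eq_sub]
  rfl

lemma vbracket_smul_right (r : RealFun I M) (X Y : VField I M) :
    vbracket X (r • Y) = r • vbracket X Y + dirDeriv X r • Y := by
  have : CompleteSpace E := FiniteDimensional.complete ℝ E
  ext p
  refine (VectorField.mlieBracket_smul_right (r.mdifferentiable p) (Y.mdiff p)).trans ?_
  rw [add_comm]
  rfl

end VectorFields

section AVectorFields

variable {E : Type*} [NormedAddCommGroup E] [NormedSpace ℝ E]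
  {H : Type*} [TopologicalSpace H] (I : ModelWithCorners ℝ E H)
  {M : Type*} [TopologicalSpace M] [ChartedSpace H M]
  (A : Type*) [CommCStarAlgebra A]

/-- The fibre `T_pM ⊗_ℝ 𝔄` of `TM^𝔄`, a free `A`-module; the factor `A` is written on the left, so
`v ⊗ a` appears as `a ⊗ₜ v`. -/
abbrev AFibre (p : M) := A ⊗[ℝ] TangentSpace I p

/-- The involution `(v ⊗ a)* = v ⊗ a*` of `T_pM ⊗_ℝ 𝔄`. -/
def starFibre (p : M) : AFibre I A p →ₗ[ℝ] AFibre I A p :=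
  LinearMap.rTensor (TangentSpace I p) ((starL' ℝ : A ≃L[ℝ] A) : A →ₗ[ℝ] A)

variable (M) [IsManifold I ∞ M]

/-- `𝔛(M)^𝔄 = 𝔛(M) ⊗_{C^∞(M)} C^∞(M, 𝔄)`: smooth `𝔄`-vector fields, a module over `C^∞(M, 𝔄)`.
The simple field `X ⊗ f` appears as `f ⊗ₜ X`. -/
abbrev AField := AFun I M A ⊗[RealFun I M] VField I M

variable {I M A}

/-- The value of an `𝔄`-vector field at a point: `(X ⊗ f)_p = X_p ⊗ f(p)`. -/
def evalField (p : M) : AField I M A →+ AFibre I A p :=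
  TensorProduct.liftAddHom
    (AddMonoidHom.mk' (fun f => AddMonoidHom.mk' (fun X => f p ⊗ₜ[ℝ] X p)
        fun X Y => TensorProduct.tmul_add (f p) (X p) (Y p))
      fun f g => by ext X; exact TensorProduct.add_tmul (f p) (g p) (X p))
    fun r f X => TensorProduct.smul_tmul (r p) (f p) (X p)

/-- The involution `(X ⊗ f)* = X ⊗ f*` of `𝔛(M)^𝔄`. -/
def starField : AField I M A →ₗ[RealFun I M] AField I M A :=
  LinearMap.rTensor (VField I M) (starFun I M A)

/-- The derivation of `C^∞(M, 𝔄)` given by an `𝔄`-vector field: `(X ⊗ h)(f) = h · X f`. -/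
def act (f : AFun I M A) : AField I M A →+ AFun I M A :=
  TensorProduct.liftAddHom
    (AddMonoidHom.mk' (fun h => AddMonoidHom.mk' (fun X => h * dirDeriv X f)
        fun X Y => by rw [dirDeriv_add_left, mul_add])
      fun h k => by ext1 X; exact add_mul h k (dirDeriv X f))
    fun r h X => by
      change (r • h) * dirDeriv X f = h * dirDeriv (r • X) f
      rw [dirDeriv_smul_left, smul_mul_assoc, mul_smul_comm]

lemma addHom_ext_tmul {P : Type*} [AddCommGroup P] {f g : AField I M A →+ P}
    (hfg : ∀ k Y, f (k ⊗ₜ[RealFun I M] Y) = g (k ⊗ₜ[RealFun I M] Y)) : f = g := by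
  ext x
  induction x using TensorProduct.induction_on with
  | zero => simp
  | tmul k Y => exact hfg k Y
  | add x y hx hy => simp [hx, hy]

variable [FiniteDimensional ℝ E]

/-- Bracket of a simple field `X ⊗ h` with an arbitrary `𝔄`-vector field. -/
def bracketSimple (h : AFun I M A) (X : VField I M) : AField I M A →+ AField I M A :=
  TensorProduct.liftAddHom
    (AddMonoidHom.mk' (fun k => AddMonoidHom.mk'
        (fun Y => (h * k) ⊗ₜ[RealFun I M] vbracket X Y
          + (h * dirDeriv X k) ⊗ₜ[RealFun I M] Y - (k * dirDeriv Y h) ⊗ₜ[RealFun I M] X)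
        fun Y Y' => by
          simp only [vbracket_add_right, dirDeriv_add_left, mul_add, TensorProduct.tmul_add,
            TensorProduct.add_tmul]
          abel)
      fun k k' => by
        ext1 Y
        simp only [AddMonoidHom.mk'_apply, AddMonoidHom.add_apply, dirDeriv_add_right, mul_add,
          add_mul, TensorProduct.add_tmul]
        abel)
    fun r k Y => by
      simp only [AddMonoidHom.mk'_apply, dirDeriv_smul_right, vbracket_smul_right,
        dirDeriv_smul_left, mul_add, TensorProduct.tmul_add, TensorProduct.add_tmul,
        mul_smul_comm, smul_mul_assoc, TensorProduct.smul_tmul', TensorProduct.tmul_smul]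
      abel

@[simp]
lemma bracketSimple_tmul (h k : AFun I M A) (X Y : VField I M) :
    bracketSimple h X (k ⊗ₜ[RealFun I M] Y) = (h * k) ⊗ₜ[RealFun I M] vbracket X Y
      + (h * dirDeriv X k) ⊗ₜ[RealFun I M] Y - (k * dirDeriv Y h) ⊗ₜ[RealFun I M] X := rfl

/-- The Lie bracket of `𝔄`-vector fields: the biadditive extension of
`[X ⊗ h, Y ⊗ k] = [X, Y] ⊗ (h k) + Y ⊗ (h X(k)) - X ⊗ (k Y(h))`. -/
def bracket : AField I M A →+ AField I M A →+ AField I M A :=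
  TensorProduct.liftAddHom
    (AddMonoidHom.mk' (M := AFun I M A) (G := VField I M →+ (AField I M A →+ AField I M A))
      (fun h => AddMonoidHom.mk' (M := VField I M) (G := AField I M A →+ AField I M A)
        (fun X => bracketSimple h X)
        fun X X' => addHom_ext_tmul fun k Y => by
          simp only [AddMonoidHom.add_apply, bracketSimple_tmul, vbracket_add_left,
            dirDeriv_add_left, mul_add, TensorProduct.tmul_add, TensorProduct.add_tmul]
          abel)
      fun h h' => by
        ext1 X
        refine addHom_ext_tmul fun k Y => ?_
        simp only [AddMonoidHom.mk'_apply, AddMonoidHom.add_apply, bracketSimple_tmul,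
          dirDeriv_add_right, mul_add, add_mul, TensorProduct.add_tmul]
        abel)
    fun r h X => addHom_ext_tmul fun k Y => by
      simp only [AddMonoidHom.mk'_apply, bracketSimple_tmul, dirDeriv_smul_right,
        vbracket_smul_left, dirDeriv_smul_left, mul_add, TensorProduct.tmul_sub,
        TensorProduct.add_tmul, mul_smul_comm, smul_mul_assoc, TensorProduct.smul_tmul',
        TensorProduct.tmul_smul]
      rw [mul_comm k h]
      abel

end AVectorFields

/-- An `𝔄`-valued inner product on an `𝔄`-module `V`. -/
structure IsInnerProduct {A : Type*} [CommCStarAlgebra A] {V : Type*} [AddCommGroup V] [Module A V]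
    (B : V → V → A) : Prop where
  conj_symm : ∀ x y, B y x = star (B x y)
  linear_left : ∀ (a : A) (x y z : V), B (a • x + y) z = a * B x z + B y z
  nondegenerate : ∀ x, (∀ w, B w x = 0) → x = 0
  representable : ∀ T : V →ₗ[A] A, ∃ x, ∀ y, T y = B y x

section Geometry

variable {E : Type*} [NormedAddCommGroup E] [NormedSpace ℝ E]
  {H : Type*} [TopologicalSpace H] (I : ModelWithCorners ℝ E H)
  (M : Type*) [TopologicalSpace M] [ChartedSpace H M] [IsManifold I ∞ M]
  (A : Type*) [CommCStarAlgebra A]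

/-- An `𝔄`-valued semi-Riemannian metric on `M`: a smooth family of `𝔄`-valued inner products on the
fibres `T_pM ⊗ 𝔄`, compatible with their involution. -/
structure AMetric where
  inner : ∀ p : M, AFibre I A p → AFibre I A p → A
  isInnerProduct : ∀ p, IsInnerProduct (inner p)
  star_compat : ∀ p u v, inner p (starFibre I A p u) (starFibre I A p v) = star (inner p u v)
  smooth : ∀ X Y : AField I M A,
    ContMDiff I 𝓘(ℝ, A) ∞ fun p => inner p (evalField p X) (evalField p Y)

/-- An `𝔄`-connection `(X, Y) ↦ ∇_X Y` on `M`. -/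
structure AConnection where
  toFun : AField I M A → AField I M A → AField I M A
  add_left : ∀ X X' Y, toFun (X + X') Y = toFun X Y + toFun X' Y
  add_right : ∀ X Y Y', toFun X (Y + Y') = toFun X Y + toFun X Y'
  smul_left : ∀ (f : AFun I M A) X Y, toFun (f • X) Y = f • toFun X Y
  leibniz : ∀ (f : AFun I M A) X Y, toFun X (f • Y) = act f X • Y + f • toFun X Y

variable {I M A}

/-- The smooth function `⟨X, Y⟩ : M → 𝔄`. -/
def AMetric.pair (g : AMetric I M A) (X Y : AField I M A) : AFun I M A :=
  ⟨fun p => g.inner p (evalField p X) (evalField p Y), g.smooth X Y⟩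

variable [FiniteDimensional ℝ E]

/-- The curvature `R(X, Y)Z = ∇_X ∇_Y Z - ∇_Y ∇_X Z - ∇_{[X, Y]} Z` of an `𝔄`-connection. -/
def AConnection.curvature (D : AConnection I M A) (X Y Z : AField I M A) : AField I M A :=
  D.toFun X (D.toFun Y Z) - D.toFun Y (D.toFun X Z) - D.toFun (bracket X Y) Z

/-- The right-hand side of the Koszul formula. -/
def AMetric.koszul (g : AMetric I M A) (X Y Z : AField I M A) : AFun I M A :=
  act (g.pair Y (starField Z)) X + act (g.pair Z (starField X)) Y - act (g.pair X (starField Y)) Z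
    + g.pair (bracket X Y) (starField Z) - g.pair (bracket Y Z) (starField X)
    + g.pair (bracket Z X) (starField Y)

/-- `D` is the Levi-Civita connection of `g`: for all `X` and `Y`, `∇_X Y` is the `𝔄`-vector field
that the Koszul formula determines. (Torsion-freeness together with
`X⟨Y, Z⟩ = ⟨∇_X Y, Z⟩ + ⟨Y, ∇_{X*} Z⟩` follows from this formula, but does not by itself determine
the connection: one may still add `i S` to it, where `S` commutes with the involutions and
`⟨S(X, Y), Z*⟩` is totally symmetric.) -/
def AMetric.IsLeviCivita (g : AMetric I M A) (D : AConnection I M A) : Prop :=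
  ∀ X Y Z : AField I M A, 2 * g.pair (D.toFun X Y) (starField Z) = g.koszul X Y Z

end Geometry

end OperatorValued

end

noncomputable section

namespace OperatorValued

open Set Filter VectorField
open scoped Topology

section DirectionalDerivative

variable {E : Type*} [NormedAddCommGroup E] [NormedSpace ℝ E]
  {H : Type*} [TopologicalSpace H] {I : ModelWithCorners ℝ E H}
  {M : Type*} [TopologicalSpace M] [ChartedSpace H M] [IsManifold I ∞ M]

lemma dirDeriv_mul {A : Type*} [CommCStarAlgebra A] (X : VField I M) (f g : AFun I M A) :
    dirDeriv X (f * g) = f * dirDeriv X g + g * dirDeriv X f := by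
  ext p
  have h := ((f.mdifferentiable p).hasMFDerivAt.mul (g.mdifferentiable p).hasMFDerivAt).mfderiv
  exact congrArg (fun L => L (X p)) h

variable {V : Type*} [NormedAddCommGroup V] [NormedSpace ℝ V]

/-- A directional derivative, computed in the chart at a point. -/
lemma fderivWithin_comp_extChartAt_symm_mpullbackWithin
    (X : VField I M) (f : C^∞⟮I, M; 𝓘(ℝ, V), V⟯) (p : M) {y : E}
    (hy : y ∈ (extChartAt I p).target) :
    fderivWithin ℝ (f ∘ (extChartAt I p).symm) (range I) y
        (mpullbackWithin 𝓘(ℝ, E) I (extChartAt I p).symm X (range I) y)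
      = dirDeriv X f ((extChartAt I p).symm y) := by
  have : IsManifold I 1 M := IsManifold.of_le (n := ∞) (by simp)
  have hyr : y ∈ range I := extChartAt_target_subset_range p hy
  have h := mfderiv_comp_mfderivWithin (I := 𝓘(ℝ, E)) (I' := I) (I'' := 𝓘(ℝ, V)) y
    (f.mdifferentiable _) (mdifferentiableWithinAt_extChartAt_symm hy)
    (I.uniqueMDiffOn y hyr)
  rw [← mfderivWithin_eq_fderivWithin, h]
  have hi := isInvertible_mfderivWithin_extChartAt_symm (I := I) hy
  have h2 : mfderivWithin 𝓘(ℝ, E) I (extChartAt I p).symm (range I) y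
      (mpullbackWithin 𝓘(ℝ, E) I (extChartAt I p).symm X (range I) y)
      = X ((extChartAt I p).symm y) := by
    rw [mpullbackWithin_apply]
    exact hi.self_apply_inverse _
  exact congrArg (mfderiv I 𝓘(ℝ, V) f ((extChartAt I p).symm y)) h2

variable [FiniteDimensional ℝ E]

lemma vbracket_swap (X Y : VField I M) : vbracket X Y = - vbracket Y X := by
  ext p; exact mlieBracket_swap_apply

lemma vbracket_leibniz (X Y Z : VField I M) :
    vbracket X (vbracket Y Z) = vbracket (vbracket X Y) Z + vbracket Y (vbracket X Z) := by
  have : CompleteSpace E := FiniteDimensional.complete ℝ E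
  have : IsManifold I (minSmoothness ℝ 3) M :=
    IsManifold.of_le (n := ∞) (by
      rw [minSmoothness_of_isRCLikeNormedField]
      exact WithTop.coe_le_coe.2 (le_top : (3 : ℕ∞) ≤ ⊤))
  have h2 : minSmoothness ℝ 2 ≤ ∞ := by
    rw [minSmoothness_of_isRCLikeNormedField]
    exact WithTop.coe_le_coe.2 (le_top : (2 : ℕ∞) ≤ ⊤)
  ext p
  exact leibniz_identity_mlieBracket_apply ((X.contMDiff p).of_le h2) ((Y.contMDiff p).of_le h2)
    ((Z.contMDiff p).of_le h2)

/-- The Lie bracket of vector fields acts on functions as the commutator. -/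
lemma dirDeriv_vbracket (X Y : VField I M) (f : C^∞⟮I, M; 𝓘(ℝ, V), V⟯) :
    dirDeriv (vbracket X Y) f = dirDeriv X (dirDeriv Y f) - dirDeriv Y (dirDeriv X f) := by
  have : CompleteSpace E := FiniteDimensional.complete ℝ E
  have h2 : (2 : WithTop ℕ∞) ≤ ∞ := WithTop.coe_le_coe.2 (le_top : (2 : ℕ∞) ≤ ⊤)
  have : IsManifold I 2 M := IsManifold.of_le (n := ∞) h2
  ext p
  have hp : extChartAt I p p ∈ (extChartAt I p).target := mem_extChartAt_target p
  have hpr : extChartAt I p p ∈ range I := extChartAt_target_subset_range p hp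
  have hd (Z : VField I M) : DifferentiableWithinAt ℝ
      (mpullbackWithin 𝓘(ℝ, E) I (extChartAt I p).symm Z (range I)) (range I)
      (extChartAt I p p) := by
    simpa using (Z.mdiff p).mdifferentiableWithinAt
      (s := univ) |>.differentiableWithinAt_mpullbackWithin_vectorField
  have hf : ContDiffWithinAt ℝ ∞ (f ∘ (extChartAt I p).symm) (range I) (extChartAt I p p) := by
    exact (contMDiffAt_iff.1 (f.contMDiff p)).2
  have hcomp (Z : VField I M) :
      (fun y => fderivWithin ℝ (f ∘ (extChartAt I p).symm) (range I) y
        (mpullbackWithin 𝓘(ℝ, E) I (extChartAt I p).symm Z (range I) y))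
      =ᶠ[𝓝[range I] (extChartAt I p p)] (dirDeriv Z f ∘ (extChartAt I p).symm) := by
    filter_upwards [extChartAt_target_mem_nhdsWithin p] with y hy
    exact fderivWithin_comp_extChartAt_symm_mpullbackWithin Z f p hy
  have hb := fderivWithin_apply_lieBracket hf
    (by rw [minSmoothness_of_isRCLikeNormedField]; exact h2) I.uniqueDiffOn
    (I.range_subset_closure_interior hpr) hpr (hd Y) (hd X)
  rw [(hcomp Y).fderivWithin_eq_of_mem hpr, (hcomp X).fderivWithin_eq_of_mem hpr,
    fderivWithin_comp_extChartAt_symm_mpullbackWithin X _ p hp,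
    fderivWithin_comp_extChartAt_symm_mpullbackWithin Y _ p hp, extChartAt_to_inv] at hb
  refine Eq.trans ?_ hb
  have hl := fderivWithin_comp_extChartAt_symm_mpullbackWithin (vbracket X Y) f p hp
  rw [extChartAt_to_inv] at hl
  rw [← hl]
  congr 1
  have hinv (w : TangentSpace 𝓘(ℝ, E) (extChartAt I p p)) :
      (mfderiv I 𝓘(ℝ, E) (extChartAt I p) p).inverse w = w := by
    rw [mfderiv_extChartAt_self]
    exact congrArg (fun L : E →L[ℝ] E => L w) ContinuousLinearMap.inverse_id
  have hv : vbracket X Y p = lieBracketWithin ℝ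
      (mpullbackWithin 𝓘(ℝ, E) I (extChartAt I p).symm X (range I))
      (mpullbackWithin 𝓘(ℝ, E) I (extChartAt I p).symm Y (range I)) (range I)
      (extChartAt I p p) := by
    refine Eq.trans (hinv _) ?_
    rw [preimage_univ, univ_inter]
  rw [mpullbackWithin_apply, extChartAt_to_inv, hv]
  exact mfderivWithin_extChartAt_symm_inverse_apply _

end DirectionalDerivative

section AVectorFieldLemmas

variable {E : Type*} [NormedAddCommGroup E] [NormedSpace ℝ E]
  {H : Type*} [TopologicalSpace H] {I : ModelWithCorners ℝ E H}
  {M : Type*} [TopologicalSpace M] [ChartedSpace H M] [IsManifold I ∞ M]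
  {A : Type*} [CommCStarAlgebra A]

@[simp]
lemma act_tmul (f h : AFun I M A) (X : VField I M) :
    act f (h ⊗ₜ[RealFun I M] X) = h * dirDeriv X f := rfl

lemma act_add_fun (f g : AFun I M A) (X : AField I M A) :
    act (f + g) X = act f X + act g X := by
  rw [← AddMonoidHom.add_apply]
  refine DFunLike.congr_fun (addHom_ext_tmul fun k Y => ?_) X
  simp [dirDeriv_add_right, mul_add]

lemma act_sub_fun (f g : AFun I M A) (X : AField I M A) :
    act (f - g) X = act f X - act g X :=
  eq_sub_of_add_eq (by rw [← act_add_fun, sub_add_cancel])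

lemma act_zero_fun (X : AField I M A) : act (0 : AFun I M A) X = 0 := by
  simpa using! act_sub_fun (0 : AFun I M A) 0 X

lemma starField_starField (X : AField I M A) : starField (starField X) = X := by
  induction X using TensorProduct.induction_on with
  | zero => simp
  | tmul k Y =>
    have h : starFun I M A (starFun I M A k) = k := by
      ext p; exact star_star (k p)
    simp [starField, h]
  | add x y hx hy => simp [hx, hy]

lemma evalField_starField (p : M) (X : AField I M A) :
    evalField p (starField X) = starFibre I A p (evalField p X) := by
  induction X using TensorProduct.induction_on with
  | zero => simp
  | tmul k Y => rfl
  | add x y hx hy => simp [hx, hy]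

section Bracket

variable [FiniteDimensional ℝ E]

@[simp]
lemma bracket_tmul_tmul (h k : AFun I M A) (X Y : VField I M) :
    bracket (h ⊗ₜ[RealFun I M] X) (k ⊗ₜ[RealFun I M] Y) = (h * k) ⊗ₜ[RealFun I M] vbracket X Y
      + (h * dirDeriv X k) ⊗ₜ[RealFun I M] Y - (k * dirDeriv Y h) ⊗ₜ[RealFun I M] X := rfl

lemma bracket_swap (X Y : AField I M A) : bracket X Y = - bracket Y X := by
  induction X using TensorProduct.induction_on with
  | zero => simp
  | add x y hx hy => simp [hx, hy]; abel
  | tmul h X =>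
    induction Y using TensorProduct.induction_on with
    | zero => simp
    | add x y hx hy => simp [hx, hy]; abel
    | tmul k Y =>
      simp only [bracket_tmul_tmul, vbracket_swap X Y, TensorProduct.tmul_neg, mul_comm h k]
      abel

/-- The bracket of `𝔄`-vector fields acts on functions as the commutator. -/
lemma act_bracket (X Y : AField I M A) (f : AFun I M A) :
    act f (bracket X Y) = act (act f Y) X - act (act f X) Y := by
  induction X using TensorProduct.induction_on with
  | zero => simp [act_zero_fun]
  | add x y hx hy => simp only [map_add, AddMonoidHom.add_apply, act_add_fun, hx, hy]; abel
  | tmul h X =>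
    induction Y using TensorProduct.induction_on with
    | zero => rw [map_zero, map_zero, map_zero, act_zero_fun]; exact (sub_zero _).symm
    | add x y hx hy => simp only [map_add, act_add_fun, hx, hy]; abel
    | tmul k Y =>
      simp only [bracket_tmul_tmul, map_add, map_sub, act_tmul, dirDeriv_vbracket, dirDeriv_mul]
      ring

lemma bracket_leibniz (X Y Z : AField I M A) :
    bracket X (bracket Y Z) = bracket (bracket X Y) Z + bracket Y (bracket X Z) := by
  induction X using TensorProduct.induction_on with
  | zero => simp
  | add x y hx hy => simp only [map_add, AddMonoidHom.add_apply, hx, hy]; abel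
  | tmul h X =>
  induction Y using TensorProduct.induction_on with
  | zero => simp
  | add x y hx hy => simp only [map_add, AddMonoidHom.add_apply, hx, hy]; abel
  | tmul k Y =>
  induction Z using TensorProduct.induction_on with
  | zero => simp
  | add x y hx hy => simp only [map_add, hx, hy]; abel
  | tmul l Z =>
    simp only [bracket_tmul_tmul, map_add, map_sub, AddMonoidHom.add_apply, AddMonoidHom.sub_apply,
      dirDeriv_vbracket, dirDeriv_mul, vbracket_leibniz X Y Z, vbracket_swap Y X,
      TensorProduct.tmul_neg, TensorProduct.tmul_add, TensorProduct.add_tmul,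
      TensorProduct.sub_tmul, mul_add, mul_sub, mul_comm, mul_left_comm]
    abel

end Bracket

end AVectorFieldLemmas

section Pairing

variable {E : Type*} [NormedAddCommGroup E] [NormedSpace ℝ E]
  {H : Type*} [TopologicalSpace H] {I : ModelWithCorners ℝ E H}
  {M : Type*} [TopologicalSpace M] [ChartedSpace H M]
  {A : Type*} [CommCStarAlgebra A]

lemma AFun.two_mul_cancel {f h : AFun I M A} (e : 2 * f = 2 * h) : f = h := by
  ext p
  rw [two_mul, two_mul] at e
  have hp : f p + f p = h p + h p := congrArg (fun k : AFun I M A => k p) e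
  rw [← two_smul ℝ, ← two_smul ℝ] at hp
  exact smul_right_injective A (two_ne_zero (α := ℝ)) hp

variable [IsManifold I ∞ M]

/-- The additive map `X ↦ ⟨X, W*⟩`. -/
def AMetric.pairStar (g : AMetric I M A) (W : AField I M A) : AField I M A →+ AFun I M A :=
  AddMonoidHom.mk' (fun X => g.pair X (starField W)) fun X Y => by
    ext p
    have h := (g.isInnerProduct p).linear_left 1 (evalField p X) (evalField p Y)
      (evalField p (starField W))
    rw [one_smul, one_mul, ← map_add] at h
    exact h

lemma AMetric.pairStar_apply (g : AMetric I M A) (W X : AField I M A) :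
    g.pairStar W X = g.pair X (starField W) := rfl

lemma AMetric.pairStar_comm (g : AMetric I M A) (X Y : AField I M A) :
    g.pairStar X Y = g.pairStar Y X := by
  ext p
  change g.inner p (evalField p Y) (evalField p (starField X))
    = g.inner p (evalField p X) (evalField p (starField Y))
  rw [(g.isInnerProduct p).conj_symm (evalField p (starField X)), ← g.star_compat,
    ← evalField_starField, ← evalField_starField, starField_starField]

end Pairing

section LeviCivita

variable {E : Type*} [NormedAddCommGroup E] [NormedSpace ℝ E]
  {H : Type*} [TopologicalSpace H] {I : ModelWithCorners ℝ E H}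
  {M : Type*} [TopologicalSpace M] [ChartedSpace H M] [IsManifold I ∞ M]
  {A : Type*} [CommCStarAlgebra A] {g : AMetric I M A} {D : AConnection I M A}

lemma AConnection.sub_right (D : AConnection I M A) (X Y Y' : AField I M A) :
    D.toFun X (Y - Y') = D.toFun X Y - D.toFun X Y' :=
  (AddMonoidHom.mk' (D.toFun X) (D.add_right X)).map_sub Y Y'

lemma AConnection.neg_left (D : AConnection I M A) (X Y : AField I M A) :
    D.toFun (-X) Y = - D.toFun X Y :=
  (AddMonoidHom.mk' (fun X => D.toFun X Y) fun X X' => D.add_left X X' Y).map_neg X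

variable [FiniteDimensional ℝ E]

lemma AConnection.curvature_swap (D : AConnection I M A) (X Y Z : AField I M A) :
    D.curvature X Y Z = - D.curvature Y X Z := by
  rw [curvature, curvature, bracket_swap X Y, D.neg_left]
  abel

namespace AMetric.IsLeviCivita

lemma koszul_eq (hD : g.IsLeviCivita D) (X Y Z : AField I M A) :
    2 * g.pairStar Z (D.toFun X Y) = act (g.pairStar Z Y) X + act (g.pairStar X Z) Y
      - act (g.pairStar Y X) Z + g.pairStar Z (bracket X Y) - g.pairStar X (bracket Y Z)
      + g.pairStar Y (bracket Z X) :=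
  hD X Y Z

/-- The Levi-Civita connection is metric. -/
lemma act_pairStar (hD : g.IsLeviCivita D) (X Y Z : AField I M A) :
    act (g.pairStar Z Y) X = g.pairStar Z (D.toFun X Y) + g.pairStar Y (D.toFun X Z) := by
  apply AFun.two_mul_cancel
  have h1 := hD.koszul_eq X Y Z
  have h2 := hD.koszul_eq X Z Y
  rw [g.pairStar_comm X Z, g.pairStar_comm Y X] at h1
  rw [bracket_swap X Z, bracket_swap Z Y, bracket_swap Y X, g.pairStar_comm Y Z, map_neg,
    map_neg, map_neg] at h2
  linear_combination -h1 - h2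

/-- The torsion of the Levi-Civita connection pairs to zero with every field. -/
lemma pairStar_torsion (hD : g.IsLeviCivita D) (X Y W : AField I M A) :
    g.pairStar W (D.toFun X Y - D.toFun Y X - bracket X Y) = 0 := by
  apply AFun.two_mul_cancel
  have h1 := hD.koszul_eq X Y W
  have h2 := hD.koszul_eq Y X W
  rw [g.pairStar_comm X W, g.pairStar_comm Y X] at h1
  rw [bracket_swap X W, bracket_swap W Y, bracket_swap Y X, g.pairStar_comm Y W, map_neg,
    map_neg, map_neg] at h2
  rw [map_sub, map_sub]
  linear_combination h1 - h2

lemma pairStar_toFun_eq_zero (hD : g.IsLeviCivita D) {T : AField I M A}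
    (hT : ∀ W, g.pairStar W T = 0) (X W : AField I M A) : g.pairStar W (D.toFun X T) = 0 := by
  have h := hD.act_pairStar X T W
  rw [hT W, act_zero_fun, g.pairStar_comm T, hT, add_zero] at h
  exact h.symm

lemma pairStar_curvature_skew (hD : g.IsLeviCivita D) (X Y Z W : AField I M A) :
    g.pairStar W (D.curvature X Y Z) = - g.pairStar Z (D.curvature X Y W) := by
  have h := act_bracket X Y (g.pairStar W Z)
  simp only [hD.act_pairStar, act_add_fun] at h
  simp only [AConnection.curvature, map_sub]
  rw [g.pairStar_comm (D.toFun Y Z), g.pairStar_comm (D.toFun Y W)] at h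
  linear_combination -h

/-- First Bianchi identity, paired with a field. -/
lemma pairStar_bianchi (hD : g.IsLeviCivita D) (X Y Z W : AField I M A) :
    g.pairStar W (D.curvature X Y Z) + g.pairStar W (D.curvature Y Z X)
      + g.pairStar W (D.curvature Z X Y) = 0 := by
  have hn (X Y Z : AField I M A) :=
    hD.pairStar_toFun_eq_zero (hD.pairStar_torsion Y Z) X W
  have ht (X Y Z : AField I M A) := hD.pairStar_torsion X (bracket Y Z) W
  have hj := congrArg (g.pairStar W) (bracket_leibniz X Y Z)
  rw [bracket_swap (bracket X Y) Z, bracket_swap X Z] at hj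
  simp only [AConnection.sub_right, map_sub, map_add, map_neg] at hn ht hj
  simp only [AConnection.curvature, map_sub]
  linear_combination hn X Y Z + hn Y Z X + hn Z X Y + ht X Y Z + ht Y Z X + ht Z X Y + hj

lemma pairStar_curvature_pair_symm (hD : g.IsLeviCivita D) (X Y Z W : AField I M A) :
    g.pairStar W (D.curvature X Y Z) = g.pairStar Y (D.curvature Z W X) := by
  apply AFun.two_mul_cancel
  have hs (X Y Z W : AField I M A) :
      g.pairStar W (D.curvature X Y Z) = - g.pairStar W (D.curvature Y X Z) := by
    rw [D.curvature_swap, map_neg]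
  have b1 := hD.pairStar_bianchi X Y Z W
  have b2 := hD.pairStar_bianchi Y Z W X
  have b3 := hD.pairStar_bianchi Z W X Y
  have b4 := hD.pairStar_bianchi W X Y Z
  have k := hD.pairStar_curvature_skew
  linear_combination b1 + b2 - b3 - b4 - k Y Z W X - k Z W Y X + hs X Z W Y - k Z X W Y
    + k W X Y Z + k X Y W Z + hs Y W X Z - k W Y X Z

end AMetric.IsLeviCivita

end LeviCivita

end OperatorValued

end

theorem proposition8p3
    {E : Type*} [NormedAddCommGroup E] [NormedSpace ℝ E] [FiniteDimensional ℝ E]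
    {H : Type*} [TopologicalSpace H] (I : ModelWithCorners ℝ E H)
    {M : Type*} [TopologicalSpace M] [ChartedSpace H M] [IsManifold I ∞ M]
    [T2Space M] [SecondCountableTopology M]
    {A : Type*} [CommCStarAlgebra A]
    (g : OperatorValued.AMetric I M A) (D : OperatorValued.AConnection I M A)
    (hD : g.IsLeviCivita D)
    (X Y Z V : OperatorValued.AField I M A) :
    g.pair (D.curvature X Y Z) V
        = - g.pair (D.curvature X Y (OperatorValued.starField V)) (OperatorValued.starField Z) ∧
      g.pair (D.curvature X Y Z) V
        = g.pair (D.curvature Z (OperatorValued.starField V) X) (OperatorValued.starField Y) := by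
  have hV : OperatorValued.starField (OperatorValued.starField V) = V :=
    OperatorValued.starField_starField V
  constructor
  · have h := hD.pairStar_curvature_skew X Y Z (OperatorValued.starField V)
    rwa [OperatorValued.AMetric.pairStar_apply, hV] at h
  · have h := hD.pairStar_curvature_pair_symm X Y Z (OperatorValued.starField V)
    rwa [OperatorValued.AMetric.pairStar_apply, hV] at h
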